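/- Let $\mathcal V$ be a variety of universal algebras, i.e. the category of all algebras satisfying a set of identities over a finitary signature, with all homomorphisms. Suppose that $\mathcal V$ is pointed (the terminal, one-point algebra $1$ is also initial) and congruence modular (the congruence lattice of each algebra in $\mathcal V$ is modular). For an algebra $X$ in $\mathcal V$, let the diagonal punctuation $DpX$ of $X$, with maps $\omega_X : X\times X\to DpX$ and $0:1\to DpX$, be the pushout in $\mathcal V$ of the diagonal $X\to X\times X$ along the terminal map $X\to 1$, and let $\eta_X=\omega_X\circ(0,1_X): X\to DpX$, so that $\eta_X(x)=\omega_X(0,x)$. Then: 1. For every $X$ in $\mathcal V$ the diagonal punctuation $DpX$ exists. It carries an internal group structure in $\mathcal V$ with unit $0$; this structure is the only internal group structure with unit $0$ on $DpX$, and it is abelian. 2. With this structure, $\eta_X$ is the universal homomorphism from $X$ to an internal abelian group of $\mathcal V$: for every internal abelian group $A$ in $\mathcal V$ and every homomorphism $f:X\to A$ there is exactly one homomorphism of internal groups $\phi:DpX\to A$ with $\phi\circ\eta_X=f$. Moreover $\eta_X$ is surjective. 3. The category $\mathrm{Ab}\,\mathcal V$ of internal abelian groups in $\mathcal V$ is a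 Birkhoff subcategory of $\mathcal V$ and a subvariety: the forgetful functor $\mathrm{Ab}\,\mathcal V\to\mathcal V$ is fully faithful and has a left adjoint, and its essential image is closed under subobjects and regular quotients and consists of exactly those algebras of $\mathcal V$ that satisfy a certain set of identities. -/

import Mathlib

open CategoryTheory Limits MonoidalCategory CartesianMonoidalCategory MonObj

universe u v

/-! ### Varieties of universal algebra

An algebraic signature is a first-order language without relation symbols, and an identity is a
pair of terms in countably many variables. -/

namespace UnivAlg

/-- The algebra `A` satisfies all the identities in `E`. -/
def Satisfies {L : FirstOrder.Language.{u, v}} (E : Set (L.Term ℕ × L.Term ℕ))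
    (A : Type u) [L.Structure A] : Prop :=
  ∀ e ∈ E, ∀ x : ℕ → A, e.1.realize x = e.2.realize x

/-- A congruence on an algebra: an equivalence relation compatible with all the operations. -/
structure Congruence (L : FirstOrder.Language.{u, v}) (A : Type u) [L.Structure A] where
  toSetoid : Setoid A
  compat : ∀ {n : ℕ} (f : L.Functions n) (x y : Fin n → A), (∀ i, toSetoid (x i) (y i)) →
    toSetoid (FirstOrder.Language.Structure.funMap f x) (FirstOrder.Language.Structure.funMap f y)

namespace Congruence

variable {L : FirstOrder.Language.{u, v}} {A : Type u} [L.Structure A]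

theorem toSetoid_injective :
    Function.Injective (toSetoid : Congruence L A → Setoid A) := by
  rintro ⟨r, hr⟩ ⟨s, hs⟩ h
  cases h
  rfl

/-- Congruences are ordered by inclusion. -/
instance : PartialOrder (Congruence L A) := PartialOrder.lift toSetoid toSetoid_injective

/-- Meets of congruences are intersections. -/
instance : InfSet (Congruence L A) where
  sInf S :=
    { toSetoid := sInf (toSetoid '' S)
      compat := by
        rintro n f x y h _ ⟨c, hc, rfl⟩
        exact c.compat f x y fun i => h i _ ⟨c, hc, rfl⟩ }

theorem isGLB_sInf (S : Set (Congruence L A)) : IsGLB S (sInf S) := by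
  constructor
  · intro c hc
    exact _root_.sInf_le (a := c.toSetoid) ⟨c, hc, rfl⟩
  · intro b hb
    refine _root_.le_sInf (a := b.toSetoid) ?_
    rintro _ ⟨c, hc, rfl⟩
    exact hb hc

/-- The lattice of congruences of an algebra. -/
instance : CompleteLattice (Congruence L A) := completeLatticeOfInf _ isGLB_sInf

end Congruence

/-- The variety of `L`-algebras defined by the set `E` of identities. (As usual in categorical
algebra, the empty algebra is allowed when `L` has no constant symbols.) -/
structure Variety (L : FirstOrder.Language.{u, v}) (E : Set (L.Term ℕ × L.Term ℕ)) where
  carrier : Type u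
  [str : L.Structure carrier]
  sat : Satisfies E carrier

attribute [instance] Variety.str

namespace Variety

variable {L : FirstOrder.Language.{u, v}} {E : Set (L.Term ℕ × L.Term ℕ)}

/-- A variety as a category, whose morphisms are all the homomorphisms of algebras. -/
instance : Category.{u} (Variety L E) where
  Hom A B := L.Hom A.carrier B.carrier
  id A := FirstOrder.Language.Hom.id L A.carrier
  comp f g := g.comp f

instance : ConcreteCategory (Variety L E) (fun A B => L.Hom A.carrier B.carrier) where
  hom f := f
  ofHom f := f

variable [L.IsAlgebraic]

/-- The one-point algebra. -/
def point (L : FirstOrder.Language.{u, v}) (E : Set (L.Term ℕ × L.Term ℕ)) [L.IsAlgebraic] :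
    Variety L E where
  carrier := PUnit.{u + 1}
  str := { funMap := fun _ _ => PUnit.unit, RelMap := fun r => isEmptyElim r }
  sat := fun _ _ _ => rfl

/-- The one-point algebra is terminal. -/
def pointIsTerminal : IsTerminal (point L E) :=
  IsTerminal.ofUniqueHom
    (fun _ =>
      { toFun := fun _ => PUnit.unit
        map_fun' := fun _ _ => rfl
        map_rel' := fun r => isEmptyElim r })
    (fun _ _ => FirstOrder.Language.Hom.ext fun _ => rfl)

/-- The operations of a product of two algebras are computed componentwise. -/
@[reducible] def prodStr (A B : Variety L E) : L.Structure (A.carrier × B.carrier) where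
  funMap f x := (FirstOrder.Language.Structure.funMap f fun i => (x i).1,
    FirstOrder.Language.Structure.funMap f fun i => (x i).2)
  RelMap r := isEmptyElim r

theorem realize_prod (A B : Variety L E) (t : L.Term ℕ) (x : ℕ → A.carrier × B.carrier) :
    @FirstOrder.Language.Term.realize L _ (prodStr A B) ℕ x t =
      (t.realize fun i => (x i).1, t.realize fun i => (x i).2) := by
  let _ := prodStr A B
  induction t with
  | var i => rfl
  | func f ts ih =>
    simp only [FirstOrder.Language.Term.realize_func, ih]
    rfl

/-- The product of two algebras. -/
def prod (A B : Variety L E) : Variety L E where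
  carrier := A.carrier × B.carrier
  str := prodStr A B
  sat e he x := by
    rw [realize_prod, realize_prod, A.sat e he, B.sat e he]

/-- The first projection. -/
def prodFst (A B : Variety L E) : prod A B ⟶ A where
  toFun p := p.1
  map_fun' _ _ := rfl
  map_rel' r := isEmptyElim r

/-- The second projection. -/
def prodSnd (A B : Variety L E) : prod A B ⟶ B where
  toFun p := p.2
  map_fun' _ _ := rfl
  map_rel' r := isEmptyElim r

/-- The homomorphism into a product with given components. -/
def prodLift {A B C : Variety L E} (f : C ⟶ A) (g : C ⟶ B) : C ⟶ prod A B where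
  toFun c := (f c, g c)
  map_fun' h x := Prod.ext
    (FirstOrder.Language.HomClass.map_fun (show L.Hom C.carrier A.carrier from f) h x)
    (FirstOrder.Language.HomClass.map_fun (show L.Hom C.carrier B.carrier from g) h x)
  map_rel' r := isEmptyElim r

/-- `prod A B` is the categorical product. -/
def prodIsLimit (A B : Variety L E) : IsLimit (BinaryFan.mk (prodFst A B) (prodSnd A B)) :=
  BinaryFan.isLimitMk (fun s => prodLift s.fst s.snd) (fun _ => rfl) (fun _ => rfl)
    (fun s _ h₁ h₂ => FirstOrder.Language.Hom.ext fun c =>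
      Prod.ext (congrArg (fun k : s.pt ⟶ A => k c) h₁) (congrArg (fun k : s.pt ⟶ B => k c) h₂))

/-- The finite products of a variety: `A ⊗ B` is `prod A B`, and `𝟙_` is the one-point algebra. -/
instance : CartesianMonoidalCategory (Variety L E) :=
  .ofChosenFiniteProducts ⟨_, pointIsTerminal⟩ fun A B => ⟨_, prodIsLimit A B⟩

instance : BraidedCategory (Variety L E) := .ofCartesianMonoidalCategory

end Variety

/-- A variety is congruence modular when the congruence lattice of each of its algebras is
modular. -/
def CongruenceModular (L : FirstOrder.Language.{u, v}) (E : Set (L.Term ℕ × L.Term ℕ)) : Prop :=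
  ∀ A : Variety L E, IsModularLattice (Congruence L A.carrier)

end UnivAlg

/-! ### Categorical notions -/

section Categorical

variable {C : Type*} [Category* C] [CartesianMonoidalCategory C]

/-- `(D, ω, z)` is a diagonal punctuation of `X`: the pushout of the diagonal `X ⟶ X ⊗ X` along
the terminal map `X ⟶ 𝟙_ C`. -/
def IsDiagonalPunctuation {X D : C} (ω : X ⊗ X ⟶ D) (z : 𝟙_ C ⟶ D) : Prop :=
  IsPushout (lift (𝟙 X) (𝟙 X)) (toUnit X) ω z

/-- The comparison `X ⟶ D`, `x ↦ ω (0, x)`, when the terminal object of the category is also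
initial; the first component is the zero morphism `X ⟶ 𝟙_ C ⟶ X`. -/
def diagonalComparison (h0 : IsInitial (𝟙_ C)) {X D : C} (ω : X ⊗ X ⟶ D) : X ⟶ D :=
  lift (toUnit X ≫ h0.to X) (𝟙 X) ≫ ω

end Categorical

/-- A fully faithful functor exhibits its source as a Birkhoff subcategory of its target: it has a
left adjoint, and its essential image is closed under subobjects and regular quotients. -/
structure IsBirkhoffSubcategory {D C : Type*} [Category* D] [Category* C] (F : D ⥤ C) : Prop where
  full : F.Full
  faithful : F.Faithful
  reflective : F.IsRightAdjoint
  of_mono : ∀ {X Y : C} (f : X ⟶ Y), Mono f → F.essImage Y → F.essImage X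
  of_regularEpi : ∀ {X Y : C} (f : X ⟶ Y), IsRegularEpi f → F.essImage X → F.essImage Y

/-! The shifting lemma carries everything. The kernels of the two projections of `A ⊗ B` meet in
equality. Modularity therefore shows that if a homomorphism `f` on `A ⊗ B` takes equal values at
`(a, b)` and `(a', b)`, it does so at `(a, b')` and `(a', b')` for every `b'` (`shift_snd`,
`shift_fst`).

The hard point is `exists_eq_zero_pair`: if `w` on `X ⊗ X` is constant on the diagonal, each `w (a,
b)` equals some `w (0, c)`. Modularity of the congruences of a free algebra gives a chain of terms
in four variables (Day terms) along which `a` is moved to `0`. Hence `η` is surjective, and `η x - η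
y = ω (y, x)` is a well-defined homomorphic subtraction on `DpX`.

By shifting, homomorphisms into an algebra with a subtraction are determined by their values on the
two axes of a product (`hom_ext_axes`). This yields the abelian group axioms, shows that every
homomorphism between internal groups is additive, and makes the group structure unique. The
universal property follows because `f y - f x` vanishes on the diagonal.

Applied to a free algebra, `exists_eq_zero_pair` expresses subtraction in all internal groups by a
single term. Carrying an internal abelian group structure is thus a matter of identities, which pass
to subalgebras and quotients. -/

namespace UnivAlg

open FirstOrder.Language.Structure

/-! ### Congruence lattices and the shifting lemma -/

namespace Congruence

variable {L : FirstOrder.Language.{u, v}} {A : Type u} [L.Structure A]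

theorem inf_apply {c d : Congruence L A} {x y : A} :
    (c ⊓ d).toSetoid x y ↔ c.toSetoid x y ∧ d.toSetoid x y := by
  constructor
  · exact fun h => ⟨inf_le_left (a := c) (b := d) h, inf_le_right (a := c) (b := d) h⟩
  · rintro ⟨h₁, h₂⟩ _ ⟨e, he, rfl⟩
    rcases he with rfl | rfl
    · exact h₁
    · exact h₂

/-- The shifting lemma. -/
theorem shifting [IsModularLattice (Congruence L A)] {p q r : Congruence L A} (h : p ⊓ q ≤ r)
    {x y z w : A} (hxy : p.toSetoid x y) (hzw : p.toSetoid z w) (hxz : q.toSetoid x z)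
    (hyw : q.toSetoid y w) (hr : r.toSetoid x z) : r.toSetoid y w := by
  -- As `q ⊓ r ≤ q`, the modular law rewrites the left side as `q ⊓ r ⊔ p ⊓ q`. The pair `(y, w)`
  -- lies in it through `y`, `x`, `z`, `w`.
  have key : (q ⊓ r ⊔ p) ⊓ q ≤ r := by
    rw [sup_inf_assoc_of_le p (inf_le_left : q ⊓ r ≤ q)]
    exact sup_le inf_le_right h
  refine key (inf_apply.2 ⟨?_, hyw⟩)
  have hp : p ≤ q ⊓ r ⊔ p := le_sup_right
  have hq : q ⊓ r ≤ q ⊓ r ⊔ p := le_sup_left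
  exact (q ⊓ r ⊔ p).toSetoid.trans (hp (p.toSetoid.symm hxy))
    ((q ⊓ r ⊔ p).toSetoid.trans (hq (inf_apply.2 ⟨hxz, hr⟩)) (hp hzw))

/-- An equivalence relation which is compatible with the operations in each argument separately
is a congruence. -/
def ofUpdate (s : Setoid A)
    (h : ∀ {n : ℕ} (f : L.Functions n) (z : Fin n → A) (i : Fin n) (x y : A), s x y →
      s (funMap f (Function.update z i x)) (funMap f (Function.update z i y))) :
    Congruence L A where
  toSetoid := s
  compat {n} f x y hxy := by
    -- The arguments are replaced one at a time; `t` is the set of those already replaced.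
    have key : ∀ t : Finset (Fin n), s (funMap f x) (funMap f (t.piecewise y x)) := by
      intro t
      induction t using Finset.induction_on with
      | empty => simp
      | insert i t hi ih =>
        refine s.trans ih ?_
        have := h f (t.piecewise y x) i (x i) (y i) (hxy i)
        rw [Finset.piecewise_insert]
        convert this using 2
        rw [Function.update_eq_self_iff.2]
        simp [hi]
    simpa using key Finset.univ

/-- The join of two congruences is the equivalence relation generated by their union. -/
theorem eqvGen_of_sup {c d : Congruence L A} {x y : A} (h : (c ⊔ d).toSetoid x y) :
    Relation.EqvGen (fun a b => c.toSetoid a b ∨ d.toSetoid a b) x y := by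
  let e : Congruence L A :=
    ofUpdate (Relation.EqvGen.setoid fun a b => c.toSetoid a b ∨ d.toSetoid a b) (by
      intro n f z i x y hxy
      induction hxy with
      | rel a b hab =>
        refine .rel _ _ (hab.imp (fun h => c.compat _ _ _ fun j => ?_)
          fun h => d.compat _ _ _ fun j => ?_)
        all_goals
          rcases eq_or_ne j i with rfl | hj
          · simpa using h
          · simp [hj]
      | refl a => exact .refl _
      | symm a b _ ih => exact .symm _ _ ih
      | trans a b c _ _ ih₁ ih₂ => exact .trans _ _ _ ih₁ ih₂)
  have hle : c ⊔ d ≤ e :=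
    sup_le (fun {a b} h => .rel _ _ (.inl h)) (fun {a b} h => .rel _ _ (.inr h))
  exact hle h

variable [L.IsAlgebraic]

/-- The operations of the quotient of an algebra by a congruence. -/
@[reducible] noncomputable def quotientStr (c : Congruence L A) :
    L.Structure (_root_.Quotient c.toSetoid) where
  funMap f x := ⟦funMap f fun i => (x i).out⟧
  RelMap r := isEmptyElim r

theorem funMap_mk (c : Congruence L A) {n : ℕ} (f : L.Functions n) (x : Fin n → A) :
    @funMap L _ c.quotientStr n f (fun i => ⟦x i⟧) = ⟦funMap f x⟧ :=
  _root_.Quotient.sound (c.compat f _ _ fun i => _root_.Quotient.mk_out (x i))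

theorem realize_mk (c : Congruence L A) (t : L.Term ℕ) (x : ℕ → A) :
    @FirstOrder.Language.Term.realize L _ c.quotientStr ℕ (fun i => ⟦x i⟧) t =
      ⟦t.realize x⟧ := by
  let _ := c.quotientStr
  induction t with
  | var i => rfl
  | func f ts ih => simp only [FirstOrder.Language.Term.realize_func, ih, funMap_mk]

end Congruence

/-! ### Homomorphisms, kernels and quotient algebras -/

namespace Variety

variable {L : FirstOrder.Language.{u, v}} {E : Set (L.Term ℕ × L.Term ℕ)}

theorem hom_ext_apply {A B : Variety L E} {f g : A ⟶ B} (h : ∀ a, f a = g a) : f = g :=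
  FirstOrder.Language.Hom.ext h

theorem map_funMap {A B : Variety L E} (f : A ⟶ B) {n : ℕ} (o : L.Functions n)
    (x : Fin n → A.carrier) : f (funMap o x) = funMap o fun i => f (x i) :=
  FirstOrder.Language.HomClass.map_fun (show L.Hom A.carrier B.carrier from f) o x

theorem map_realize {A B : Variety L E} (f : A ⟶ B) (t : L.Term ℕ) (x : ℕ → A.carrier) :
    f (t.realize x) = t.realize fun i => f (x i) :=
  (FirstOrder.Language.HomClass.realize_term (show L.Hom A.carrier B.carrier from f)).symm

/-- The kernel congruence of a homomorphism. -/
def ker {A B : Variety L E} (f : A ⟶ B) : Congruence L A.carrier where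
  toSetoid := Setoid.ker f
  compat o x y h := by
    change f _ = f _
    rw [map_funMap, map_funMap]
    exact congrArg _ (funext h)

theorem ker_apply {A B : Variety L E} {f : A ⟶ B} {x y : A.carrier} :
    (ker f).toSetoid x y ↔ f x = f y := Iff.rfl

theorem satisfies_of_injective {A B : Variety L E} (f : A ⟶ B) (hf : Function.Injective f)
    {E' : Set (L.Term ℕ × L.Term ℕ)} (h : Satisfies E' B.carrier) : Satisfies E' A.carrier :=
  fun e he x => hf (by rw [map_realize, map_realize, h e he])

theorem satisfies_of_surjective {A B : Variety L E} (f : A ⟶ B) (hf : Function.Surjective f)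
    {E' : Set (L.Term ℕ × L.Term ℕ)} (h : Satisfies E' A.carrier) : Satisfies E' B.carrier := by
  intro e he x
  obtain ⟨y, rfl⟩ := hf.comp_left (α := ℕ) x
  have := congrArg f (h e he y)
  rwa [map_realize, map_realize] at this

theorem mono_of_injective {A B : Variety L E} (f : A ⟶ B) (hf : Function.Injective f) : Mono f :=
  ⟨fun _ _ h => hom_ext_apply fun a => hf (congrArg (fun k => k a) h)⟩

theorem surjective_of_isIso {A B : Variety L E} (f : A ⟶ B) [IsIso f] : Function.Surjective f :=
  fun b => ⟨inv f b, congrArg (fun k => k b) (IsIso.inv_hom_id f)⟩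

variable [L.IsAlgebraic]

/-- A homomorphism from a map compatible with the operations. -/
def homMk {A B : Variety L E} (f : A.carrier → B.carrier)
    (h : ∀ {n : ℕ} (o : L.Functions n) (x : Fin n → A.carrier),
      f (funMap o x) = funMap o fun i => f (x i)) : A ⟶ B :=
  (⟨f, h, fun r => isEmptyElim r⟩ : L.Hom A.carrier B.carrier)

/-- The quotient of an algebra by a congruence. -/
noncomputable def quot (A : Variety L E) (c : Congruence L A.carrier) : Variety L E where
  carrier := _root_.Quotient c.toSetoid
  str := c.quotientStr
  sat e he x := by
    obtain ⟨y, rfl⟩ := (_root_.Quotient.mk_surjective (s := c.toSetoid)).comp_left (α := ℕ) x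
    exact (c.realize_mk _ _).trans ((congrArg _ (A.sat e he y)).trans (c.realize_mk _ _).symm)

/-- The projection onto a quotient. -/
noncomputable def quotMk (A : Variety L E) (c : Congruence L A.carrier) : A ⟶ quot A c :=
  homMk (fun a => ⟦a⟧) fun o x => (c.funMap_mk o x).symm

theorem quotMk_surjective (A : Variety L E) (c : Congruence L A.carrier) :
    Function.Surjective (quotMk A c) := _root_.Quotient.mk_surjective

theorem quotMk_eq_iff {A : Variety L E} {c : Congruence L A.carrier} {x y : A.carrier} :
    quotMk A c x = quotMk A c y ↔ c.toSetoid x y := _root_.Quotient.eq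

/-- A homomorphism factors through each surjective homomorphism with a smaller kernel. -/
noncomputable def descend {A B C : Variety L E} (q : A ⟶ B) (hq : Function.Surjective q)
    (f : A ⟶ C) (h : ∀ x y, q x = q y → f x = f y) : B ⟶ C :=
  homMk (fun b => f (Function.surjInv hq b)) fun o x => by
    rw [← map_funMap]
    refine h _ _ ((Function.surjInv_eq hq _).trans ?_)
    rw [map_funMap]
    exact congrArg _ (funext fun i => (Function.surjInv_eq hq (x i)).symm)

theorem descend_apply {A B C : Variety L E} (q : A ⟶ B) (hq : Function.Surjective q)
    (f : A ⟶ C) (h : ∀ x y, q x = q y → f x = f y) (a : A.carrier) :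
    descend q hq f h (q a) = f a :=
  h _ _ (Function.surjInv_eq hq (q a))

/-- The quotient by the kernel embeds in `B`. This embedding is mono, and strong epi as the second
factor of `f`, hence an isomorphism. -/
theorem surjective_of_isRegularEpi {A B : Variety L E} (f : A ⟶ B) [IsRegularEpi f] :
    Function.Surjective f := by
  let i : quot A (ker f) ⟶ B :=
    descend (quotMk A (ker f)) (quotMk_surjective _ _) f fun x y h => quotMk_eq_iff.1 h
  have hi (a) : i (quotMk A (ker f) a) = f a := descend_apply _ _ _ _ a
  have : Mono i := by
    refine mono_of_injective i fun x y h => ?_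
    obtain ⟨x, rfl⟩ := quotMk_surjective _ _ x
    obtain ⟨y, rfl⟩ := quotMk_surjective _ _ y
    rw [hi, hi] at h
    exact quotMk_eq_iff.2 h
  have hfac : quotMk A (ker f) ≫ i = f := hom_ext_apply hi
  have : StrongEpi i := by
    have : StrongEpi (quotMk A (ker f) ≫ i) := by
      rw [hfac]
      infer_instance
    exact strongEpi_of_strongEpi (quotMk A (ker f)) i
  have := isIso_of_mono_of_strongEpi i
  intro b
  obtain ⟨x, rfl⟩ := surjective_of_isIso i b
  obtain ⟨a, rfl⟩ := quotMk_surjective _ _ x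
  exact ⟨a, (hi a).symm⟩

/-! ### Free algebras -/

variable (L E) in
/-- Two terms are identified when they agree in all the algebras of the variety. -/
def termSetoid : Setoid (L.Term ℕ) where
  r s t := ∀ (A : Variety L E) (x : ℕ → A.carrier), s.realize x = t.realize x
  iseqv := ⟨fun _ _ _ => rfl, fun h A x => (h A x).symm, fun h h' A x => (h A x).trans (h' A x)⟩

variable (L E) in
/-- The operations of the free algebra. -/
@[reducible] noncomputable def freeStr : L.Structure (_root_.Quotient (termSetoid L E)) where
  funMap f x := ⟦.func f fun i => (x i).out⟧
  RelMap r := isEmptyElim r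

theorem free_funMap_mk {n : ℕ} (f : L.Functions n) (t : Fin n → L.Term ℕ) :
    @funMap L _ (freeStr L E) n f (fun i => ⟦t i⟧) = ⟦.func f t⟧ := by
  refine _root_.Quotient.sound fun A x => ?_
  simp only [FirstOrder.Language.Term.realize_func]
  exact congrArg _ (funext fun i => _root_.Quotient.mk_out (s := termSetoid L E) (t i) A x)

theorem free_realize_mk (t : L.Term ℕ) (x : ℕ → L.Term ℕ) :
    @FirstOrder.Language.Term.realize L _ (freeStr L E) ℕ (fun i => ⟦x i⟧) t = ⟦t.subst x⟧ := by
  let _ := freeStr L E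
  induction t with
  | var i => rfl
  | func f ts ih =>
    simp only [FirstOrder.Language.Term.realize_func, ih, free_funMap_mk]
    rfl

variable (L E) in
/-- The free algebra on countably many generators. -/
noncomputable def free : Variety L E where
  carrier := _root_.Quotient (termSetoid L E)
  str := freeStr L E
  sat e he x := by
    obtain ⟨y, rfl⟩ := (_root_.Quotient.mk_surjective (s := termSetoid L E)).comp_left (α := ℕ) x
    refine (free_realize_mk _ _).trans (Eq.trans ?_ (free_realize_mk _ _).symm)
    refine _root_.Quotient.sound fun A x => ?_
    rw [FirstOrder.Language.Term.realize_subst, FirstOrder.Language.Term.realize_subst,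
      A.sat e he]

variable (E) in
/-- The class of a term in the free algebra. -/
noncomputable def freeMk (t : L.Term ℕ) : (free L E).carrier := Quotient.mk (termSetoid L E) t

theorem freeMk_surjective : Function.Surjective (freeMk (L := L) E) :=
  _root_.Quotient.mk_surjective

/-- The homomorphism from the free algebra with given values at the generators. -/
noncomputable def freeLift {A : Variety L E} (x : ℕ → A.carrier) : free L E ⟶ A :=
  homMk (_root_.Quotient.lift (fun t : L.Term ℕ => t.realize x) fun _ _ h => h A x) (by
    intro n o t
    obtain ⟨t, rfl⟩ := (_root_.Quotient.mk_surjective (s := termSetoid L E)).comp_left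
      (α := Fin n) t
    exact congrArg _ (free_funMap_mk o t))

theorem freeLift_mk {A : Variety L E} (x : ℕ → A.carrier) (t : L.Term ℕ) :
    freeLift x (freeMk E t) = t.realize x := rfl

/-- The generators of the free algebra. -/
noncomputable def gen (i : ℕ) : (free L E).carrier := freeMk E (.var i)

theorem map_freeLift {A B : Variety L E} (f : A ⟶ B) (x : ℕ → A.carrier)
    (m : (free L E).carrier) : f (freeLift x m) = freeLift (fun i => f (x i)) m := by
  obtain ⟨t, rfl⟩ := freeMk_surjective m
  exact map_realize f t x

theorem freeLift_const {A : Variety L E} {a : A.carrier}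
    (ha : ∀ {n : ℕ} (o : L.Functions n), funMap o (fun _ => a) = a) (m : (free L E).carrier) :
    freeLift (fun _ => a) m = a := by
  obtain ⟨t, rfl⟩ := freeMk_surjective m
  rw [freeLift_mk]
  induction t with
  | var i => rfl
  | func f ts ih => simp only [FirstOrder.Language.Term.realize_func, ih, ha]

/-- Elements are seen by homomorphisms from the free algebra. -/
theorem injective_of_mono {A B : Variety L E} (f : A ⟶ B) [Mono f] : Function.Injective f := by
  intro a b h
  have key : freeLift (fun _ => a) ≫ f = freeLift (fun _ => b) ≫ f := hom_ext_apply fun m => by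
    change f (freeLift _ m) = f (freeLift _ m)
    rw [map_freeLift, map_freeLift, h]
  exact congrArg (fun k => k (gen 0)) ((cancel_mono f).1 key)

/-! ### Pairs -/

/-- The pair of two elements, as an element of the categorical product. -/
def pair {A B : Variety L E} (a : A.carrier) (b : B.carrier) : (A ⊗ B).carrier := (a, b)

theorem eq_pair {A B : Variety L E} (p : (A ⊗ B).carrier) : ∃ a b, p = pair a b := ⟨p.1, p.2, rfl⟩

theorem freeLift_pair {A B : Variety L E} (x : ℕ → A.carrier) (y : ℕ → B.carrier)
    (m : (free L E).carrier) :
    freeLift (fun i => pair (x i) (y i)) m = pair (freeLift x m) (freeLift y m) := by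
  have h₁ := map_freeLift (fst A B) (fun i => pair (x i) (y i)) m
  have h₂ := map_freeLift (snd A B) (fun i => pair (x i) (y i)) m
  exact Prod.ext h₁ h₂

/-! ### The shifting lemma for products -/

/-- This is the shifting lemma for the kernels of the two projections, whose meet is equality. -/
theorem shift_snd (hm : CongruenceModular L E) {A B C : Variety L E} (f : A ⊗ B ⟶ C)
    {a a' : A.carrier} {b : B.carrier} (h : f (pair a b) = f (pair a' b)) (b' : B.carrier) :
    f (pair a b') = f (pair a' b') := by
  have := hm (A ⊗ B)
  refine Congruence.shifting (p := ker (fst A B)) (q := ker (snd A B)) (r := ker f)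
    (x := pair a b) (y := pair a b') (z := pair a' b) (w := pair a' b')
    (fun {x y} hxy => ?_) rfl rfl rfl rfl h
  obtain ⟨h₁, h₂⟩ := Congruence.inf_apply.1 hxy
  have : x = y := Prod.ext h₁ h₂
  exact congrArg f this

theorem shift_fst (hm : CongruenceModular L E) {A B C : Variety L E} (f : A ⊗ B ⟶ C)
    {b b' : B.carrier} {a : A.carrier} (h : f (pair a b) = f (pair a b')) (a' : A.carrier) :
    f (pair a' b) = f (pair a' b') := by
  have := hm (A ⊗ B)
  refine Congruence.shifting (p := ker (snd A B)) (q := ker (fst A B)) (r := ker f)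
    (x := pair a b) (y := pair a' b) (z := pair a b') (w := pair a' b')
    (fun {x y} hxy => ?_) rfl rfl rfl rfl h
  obtain ⟨h₁, h₂⟩ := Congruence.inf_apply.1 hxy
  have : x = y := Prod.ext h₂ h₁
  exact congrArg f this

/-! ### The zero element of an algebra -/

/-- The zero element of an algebra of a pointed variety. -/
def zero (h0 : IsInitial (𝟙_ (Variety L E))) (A : Variety L E) : A.carrier :=
  h0.to A PUnit.unit

theorem map_zero (h0 : IsInitial (𝟙_ (Variety L E))) {A B : Variety L E} (f : A ⟶ B) :
    f (zero h0 A) = zero h0 B :=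
  congrArg (fun k : 𝟙_ (Variety L E) ⟶ B => k PUnit.unit) (h0.hom_ext (h0.to A ≫ f) (h0.to B))

theorem hom_unit_apply (h0 : IsInitial (𝟙_ (Variety L E))) {A : Variety L E}
    (z : 𝟙_ (Variety L E) ⟶ A) (p : (𝟙_ (Variety L E) : Variety L E).carrier) :
    z p = zero h0 A :=
  congrArg (fun k : 𝟙_ (Variety L E) ⟶ A => k PUnit.unit) (h0.hom_ext z (h0.to A))

theorem funMap_zero (h0 : IsInitial (𝟙_ (Variety L E))) (A : Variety L E) {n : ℕ}
    (o : L.Functions n) : funMap o (fun _ => zero h0 A) = zero h0 A :=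
  (map_funMap (h0.to A) o fun _ => PUnit.unit).symm

/-- The zero homomorphism. -/
def zeroHom (h0 : IsInitial (𝟙_ (Variety L E))) (A B : Variety L E) : A ⟶ B :=
  toUnit A ≫ h0.to B

theorem pair_zero (h0 : IsInitial (𝟙_ (Variety L E))) (A B : Variety L E) :
    pair (zero h0 A) (zero h0 B) = zero h0 (A ⊗ B) :=
  Prod.ext (map_zero h0 (fst A B)).symm (map_zero h0 (snd A B)).symm

/-! ### Homomorphisms constant on the diagonal -/

/-- The assignment sending the first four generators to given elements. -/
def quad {T : Type*} (x y z w : T) : ℕ → T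
  | 0 => x
  | 1 => y
  | 2 => z
  | _ => w

theorem map_quad {T S : Type*} (f : T → S) (x y z w : T) :
    (fun i => f (quad x y z w i)) = quad (f x) (f y) (f z) (f w) := by
  funext i
  match i with
  | 0 => rfl
  | 1 => rfl
  | 2 => rfl
  | _ + 3 => rfl

theorem map_freeLift_quad {A B : Variety L E} (f : A ⟶ B) (x y z w : A.carrier)
    (m : (free L E).carrier) :
    f (freeLift (quad x y z w) m) = freeLift (quad (f x) (f y) (f z) (f w)) m := by
  rw [map_freeLift, map_quad]

theorem map_pair_freeLift_quad {A B C : Variety L E} (f : A ⊗ B ⟶ C) (x y z w : A.carrier)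
    (x' y' z' w' : B.carrier) (m : (free L E).carrier) :
    f (pair (freeLift (quad x y z w) m) (freeLift (quad x' y' z' w') m)) =
      freeLift (quad (f (pair x x')) (f (pair y y')) (f (pair z z')) (f (pair w w'))) m := by
  rw [← freeLift_pair, ← map_quad (fun p => f p), ← map_freeLift]
  refine congrArg (fun k => f (freeLift k m)) (funext fun i => ?_)
  match i with
  | 0 => rfl
  | 1 => rfl
  | 2 => rfl
  | _ + 3 => rfl

section Diagonal

variable {X D : Variety L E} {w : X ⊗ X ⟶ D}

theorem eq_diag_of_eq (hm : CongruenceModular L E) (hw : ∀ x y, w (pair x x) = w (pair y y))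
    {a p q : X.carrier} (h : w (pair a p) = w (pair a q)) : w (pair p q) = w (pair q q) :=
  (shift_fst hm w h p).symm.trans (hw p q)

/-- In the free algebra on `x, y, z, u`, the pair `(x, u)` lies in the join of the kernel of
`u ↦ x, z ↦ y` intersected with that of `y ↦ x, z ↦ u`, and the kernel of `z ↦ y`. -/
theorem eqvGen_free (hm : CongruenceModular L E) :
    Relation.EqvGen (fun m m' : (free L E).carrier =>
      (freeLift (A := free L E) (quad (gen 0) (gen 1) (gen 1) (gen 0)) m =
          freeLift (quad (gen 0) (gen 1) (gen 1) (gen 0)) m' ∧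
        freeLift (A := free L E) (quad (gen 0) (gen 0) (gen 3) (gen 3)) m =
          freeLift (quad (gen 0) (gen 0) (gen 3) (gen 3)) m') ∨
      freeLift (A := free L E) (quad (gen 0) (gen 1) (gen 1) (gen 3)) m =
        freeLift (quad (gen 0) (gen 1) (gen 1) (gen 3)) m') (gen 0) (gen 3) := by
  have := hm (free L E)
  let p := ker (freeLift (A := free L E) (quad (gen 0) (gen 0) (gen 3) (gen 3)))
  let q := ker (freeLift (A := free L E) (quad (gen 0) (gen 1) (gen 1) (gen 0)))
  let r := ker (freeLift (A := free L E) (quad (gen 0) (gen 1) (gen 1) (gen 3)))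
  have hrq : r ≤ q := by
    intro m m' h
    have h' := congrArg
      (freeLift (A := free L E) (quad (gen 0) (gen 1) (gen 1) (gen 0))) (ker_apply.1 h)
    rwa [map_freeLift_quad, map_freeLift_quad] at h'
  have hp : p ≤ r ⊔ p := le_sup_right
  have hr : r ≤ r ⊔ p := le_sup_left
  -- The chain is `x p y r z p u`, while `x q u` holds directly; modularity with `r ≤ q` then gives
  -- `r ⊔ p ⊓ q`.
  have key : ((r ⊔ p) ⊓ q).toSetoid (gen 0) (gen 3) :=
    Congruence.inf_apply.2 ⟨(r ⊔ p).toSetoid.trans (hp (y := gen 1) rfl)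
      ((r ⊔ p).toSetoid.trans (hr (y := gen 2) rfl) (hp rfl)), rfl⟩
  rw [sup_inf_assoc_of_le p hrq, sup_comm] at key
  refine (Congruence.eqvGen_of_sup key).mono fun m m' h => ?_
  exact h.imp (fun h => (Congruence.inf_apply.1 h).symm) id

/-- A homomorphism `w : X ⊗ X ⟶ D` constant on the diagonal takes all its values at the pairs
`(0, c)`. -/
theorem exists_eq_zero_pair (h0 : IsInitial (𝟙_ (Variety L E))) (hm : CongruenceModular L E)
    (hw : ∀ x y, w (pair x x) = w (pair y y)) (a b : X.carrier) :
    ∃ c, w (pair a b) = w (pair (zero h0 X) c) := by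
  set o := zero h0 X
  let ev (x y z u : X.carrier) (m : (free L E).carrier) : X.carrier := freeLift (quad x y z u) m
  have hev (x y z u x' y' z' u' : X.carrier) (m) : w (pair (ev x y z u m) (ev x' y' z' u' m)) =
      freeLift (quad (w (pair x x')) (w (pair y y')) (w (pair z z')) (w (pair u u'))) m :=
    map_pair_freeLift_quad ..
  let q := freeLift (A := free L E) (quad (gen 0) (gen 1) (gen 1) (gen 0))
  -- The value `w (a, b)` can be rewritten as `w (e, c)` with `e` equivalent to `m (a, t, 0, 0)`.
  -- For `m = x` take `e = a`; for `m = u` the element `e` is equivalent to `0`, which is the goal.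
  let Q (m : (free L E).carrier) (t : X.carrier) : Prop :=
    ∃ e c, w (pair a b) = w (pair e c) ∧ w (pair e (ev a t o o m)) =
      w (pair (ev a t o o m) (ev a t o o m))
  have hq {m} (h : q m = gen 0) (x y : X.carrier) : ev x y y x m = x := by
    have := congrArg (freeLift (quad x y y x)) h
    rwa [map_freeLift_quad] at this
  -- Since `w (t', t') = w (t, t)` and `m (x, y, y, x) = x`, applying `m (-, t', t, -)` to `e` and
  -- `c` preserves `w (e, c)`.
  have change {m t} (h : q m = gen 0) (t' : X.carrier) (hQ : Q m t) : Q m t' := by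
    obtain ⟨e, c, h₁, h₂⟩ := hQ
    refine ⟨ev e t' t e m, ev c t' t c m, ?_, ?_⟩
    · rw [h₁, hev, hw t' t, ← hev, hq h, hq h]
    · generalize hV : ev a t o o m = V at h₂
      have h₃ : w (pair (ev e t' t e m) (ev V t' t V m)) =
          w (pair (ev V t' t V m) (ev V t' t V m)) := by
        rw [hev, h₂, ← hev]
      -- Write the first `V` as `m (V, t, t, V)` and apply `m` to values of `w`. Diagonal values are
      -- interchangeable, so this becomes `w (m (a, t, 0, 0), m (a, t', 0, 0))`, whose first entry
      -- is again `V`.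
      have h₄ : w (pair V (ev V t' t V m)) = w (pair V (ev a t' o o m)) := by
        conv_lhs => rw [← hq h V t, hq h V t]
        have h₅ : w (pair (ev V t t V m) (ev V t' t V m)) =
            w (pair (ev a t o o m) (ev a t' o o m)) := by
          rw [hev, hev, hw V o, hw t o, hw a o]
        rwa [hq h, hV] at h₅
      exact (shift_snd hm w h₃ _).trans (eq_diag_of_eq hm hw h₄)
  let P (m : (free L E).carrier) : Prop := q m = gen 0 ∧ ∀ t, Q m t
  have step {m m'} (h : (q m = q m' ∧
        freeLift (A := free L E) (quad (gen 0) (gen 0) (gen 3) (gen 3)) m =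
          freeLift (quad (gen 0) (gen 0) (gen 3) (gen 3)) m') ∨
      freeLift (A := free L E) (quad (gen 0) (gen 1) (gen 1) (gen 3)) m =
        freeLift (quad (gen 0) (gen 1) (gen 1) (gen 3)) m') (hP : P m) : P m' := by
    obtain ⟨hm₁, hm₂⟩ := hP
    rcases h with ⟨h₁, h₂⟩ | h₁
    -- Here `m` and `m'` agree at `(x, x, u, u)`, so `t = a` passes from one to the other; in the
    -- second case they agree when `z = y`, and `t = 0` serves. The freedom in `t` joins the two
    -- kinds of links.
    · have hm₃ : q m' = gen 0 := h₁ ▸ hm₁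
      refine ⟨hm₃, fun t => change hm₃ t (t := a) ?_⟩
      have h₃ : ev a a o o m = ev a a o o m' := by
        have := congrArg (freeLift (quad a a o o)) h₂
        rwa [map_freeLift_quad, map_freeLift_quad] at this
      have := hm₂ a
      simp only [Q] at this ⊢
      rwa [← h₃]
    · have hm₃ : q m' = gen 0 := by
        have := congrArg q h₁
        simp only [q, map_freeLift_quad] at this
        exact this.symm.trans hm₁
      refine ⟨hm₃, fun t => change hm₃ t (t := o) ?_⟩
      have h₃ : ev a o o o m = ev a o o o m' := by
        have := congrArg (freeLift (quad a o o o)) h₁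
        rwa [map_freeLift_quad, map_freeLift_quad] at this
      have := hm₂ o
      simp only [Q] at this ⊢
      rwa [← h₃]
  have hP : P (gen 0) ↔ P (gen 3) := by
    refine (Relation.EqvGen.rec (motive := fun m m' _ => P m ↔ P m') ?_ ?_ ?_ ?_
      (eqvGen_free hm) : P (gen 0) ↔ P (gen 3))
    · exact fun m m' h => ⟨step h, step (h.imp (fun h => ⟨h.1.symm, h.2.symm⟩) Eq.symm)⟩
    · exact fun _ => Iff.rfl
    · exact fun _ _ _ => Iff.symm
    · exact fun _ _ _ _ _ => Iff.trans
  obtain ⟨e, c, h₁, h₂⟩ := (hP.1 ⟨rfl, fun t => ⟨a, b, rfl, rfl⟩⟩).2 o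
  exact ⟨c, h₁.trans (shift_snd hm w (a := e) (a' := o) h₂ c)⟩

end Diagonal

/-! ### Internal subtractions -/

/-- A homomorphism `s : D ⊗ D ⟶ D` such that `s (a, a) = 0` and `s (a, 0) = a`. -/
structure IsSubtraction (h0 : IsInitial (𝟙_ (Variety L E))) {D : Variety L E} (s : D ⊗ D ⟶ D) :
    Prop where
  self (a : D.carrier) : s (pair a a) = zero h0 D
  right_zero (a : D.carrier) : s (pair a (zero h0 D)) = a

namespace IsSubtraction

variable {h0 : IsInitial (𝟙_ (Variety L E))} {D : Variety L E} {s : D ⊗ D ⟶ D}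

/-- Shift `s (a, b) = s (b, b)` to second coordinate `0`. -/
theorem eq_of_eq_zero (hs : IsSubtraction h0 s) (hm : CongruenceModular L E) {a b : D.carrier}
    (h : s (pair a b) = zero h0 D) : a = b := by
  have := shift_snd hm s (h.trans (hs.self b).symm) (zero h0 D)
  rwa [hs.right_zero, hs.right_zero] at this

/-- Homomorphisms to `D` from a product agree when they agree on both axes. -/
theorem hom_ext_axes (hs : IsSubtraction h0 s) (hm : CongruenceModular L E) {A B : Variety L E}
    {f g : A ⊗ B ⟶ D} (h₁ : ∀ a, f (pair a (zero h0 B)) = g (pair a (zero h0 B)))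
    (h₂ : ∀ b, f (pair (zero h0 A) b) = g (pair (zero h0 A) b)) : f = g := by
  refine hom_ext_apply fun p => ?_
  obtain ⟨a, b, rfl⟩ := eq_pair p
  refine hs.eq_of_eq_zero hm ?_
  have h₃ (p) (h : f p = g p) : (lift f g ≫ s) p = zero h0 D := by
    change s (pair (f p) (g p)) = _
    rw [h, hs.self]
  -- The difference of `f` and `g` vanishes at `(a, 0)` and `(0, 0)`, so by shifting its value at
  -- `(a, b)` is that at `(0, b)`, which is zero.
  exact (shift_snd hm (lift f g ≫ s) ((h₃ _ (h₁ a)).trans (h₃ _ (h₁ _)).symm) b).trans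
    (h₃ _ (h₂ b))

/-- The expression `(a - (a - b)) - b` vanishes for `b = 0`, so shifting makes it independent of
`a`; at `a = b` it is zero. -/
theorem sub_sub (hs : IsSubtraction h0 s) (hm : CongruenceModular L E) (a b : D.carrier) :
    s (pair a (s (pair a b))) = b := by
  let f : D ⊗ D ⟶ D := lift (lift (fst D D) s ≫ s) (snd D D) ≫ s
  have hf (a b) : f (pair a b) = s (pair (s (pair a (s (pair a b)))) b) := rfl
  have h₁ (a) : f (pair a (zero h0 D)) = zero h0 D := by
    rw [hf, hs.right_zero, hs.right_zero, hs.self]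
  have h₂ : f (pair b b) = zero h0 D := by rw [hf, hs.self, hs.right_zero, hs.self]
  refine hs.eq_of_eq_zero hm ?_
  rw [← hf, shift_snd hm f ((h₁ a).trans (h₁ b).symm) b, h₂]

/-- The inversion defined by a subtraction. -/
def neg (_ : IsSubtraction h0 s) : D ⟶ D := lift (zeroHom h0 D D) (𝟙 D) ≫ s

theorem neg_apply (hs : IsSubtraction h0 s) (a : D.carrier) :
    hs.neg a = s (pair (zero h0 D) a) := rfl

/-- The addition defined by a subtraction. -/
def add (hs : IsSubtraction h0 s) : D ⊗ D ⟶ D := lift (fst D D) (snd D D ≫ hs.neg) ≫ s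

theorem add_apply (hs : IsSubtraction h0 s) (a b : D.carrier) :
    hs.add (pair a b) = s (pair a (hs.neg b)) := rfl

theorem add_zero (hs : IsSubtraction h0 s) (a : D.carrier) :
    hs.add (pair a (zero h0 D)) = a := by
  rw [add_apply, map_zero h0, hs.right_zero]

theorem zero_add (hs : IsSubtraction h0 s) (hm : CongruenceModular L E) (a : D.carrier) :
    hs.add (pair (zero h0 D) a) = a :=
  hs.sub_sub hm _ a

theorem add_neg (hs : IsSubtraction h0 s) (hm : CongruenceModular L E) (a : D.carrier) :
    hs.add (pair a (hs.neg a)) = zero h0 D := by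
  rw [add_apply, neg_apply hs (hs.neg a), neg_apply, hs.sub_sub hm, hs.self]

theorem add_comm (hs : IsSubtraction h0 s) (hm : CongruenceModular L E) (a b : D.carrier) :
    hs.add (pair a b) = hs.add (pair b a) := by
  have : hs.add = lift (snd D D) (fst D D) ≫ hs.add := by
    refine hs.hom_ext_axes hm (fun a => ?_) fun b => ?_
    · exact (hs.add_zero a).trans (hs.zero_add hm a).symm
    · exact (hs.zero_add hm b).trans (hs.add_zero b).symm
  exact congrArg (fun k => k (pair a b)) this

theorem add_assoc (hs : IsSubtraction h0 s) (hm : CongruenceModular L E) (a b c : D.carrier) :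
    hs.add (pair (hs.add (pair a b)) c) = hs.add (pair a (hs.add (pair b c))) := by
  have : lift (fst (D ⊗ D) D ≫ hs.add) (snd (D ⊗ D) D) ≫ hs.add =
      lift (fst (D ⊗ D) D ≫ fst D D)
        (lift (fst (D ⊗ D) D ≫ snd D D) (snd (D ⊗ D) D) ≫ hs.add) ≫ hs.add := by
    refine hs.hom_ext_axes hm (fun p => ?_) fun c => ?_
    · obtain ⟨a, b, rfl⟩ := eq_pair p
      change hs.add (pair (hs.add (pair a b)) (zero h0 D)) =
        hs.add (pair a (hs.add (pair b (zero h0 D))))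
      rw [add_zero, add_zero]
    · rw [← pair_zero h0]
      change hs.add (pair (hs.add (pair (zero h0 D) (zero h0 D))) c) =
        hs.add (pair (zero h0 D) (hs.add (pair (zero h0 D) c)))
      rw [hs.zero_add hm, hs.zero_add hm, hs.zero_add hm]
  exact congrArg (fun k => k (pair (pair a b) c)) this

/-- The internal group defined by a subtraction. -/
@[reducible] def grpObj (hs : IsSubtraction h0 s) (hm : CongruenceModular L E) : GrpObj D where
  one := h0.to D
  mul := hs.add
  one_mul := hom_ext_apply fun p => by
    obtain ⟨a, b, rfl⟩ := eq_pair p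
    exact hs.zero_add hm b
  mul_one := hom_ext_apply fun p => by
    obtain ⟨a, b, rfl⟩ := eq_pair p
    exact hs.add_zero a
  mul_assoc := hom_ext_apply fun p => by
    obtain ⟨q, c, rfl⟩ := eq_pair p
    obtain ⟨a, b, rfl⟩ := eq_pair q
    exact hs.add_assoc hm a b c
  inv := hs.neg
  left_inv := hom_ext_apply fun a => (hs.add_comm hm _ _).trans (hs.add_neg hm a)
  right_inv := hom_ext_apply fun a => hs.add_neg hm a

theorem isCommMonObj (hs : IsSubtraction h0 s) (hm : CongruenceModular L E) :
    @IsCommMonObj _ _ _ _ D (hs.grpObj hm).toMonObj :=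
  let _ := hs.grpObj hm
  ⟨hom_ext_apply fun p => by
    obtain ⟨a, b, rfl⟩ := eq_pair p
    exact hs.add_comm hm b a⟩

end IsSubtraction

/-! ### Internal groups and their homomorphisms -/

section GrpObj

variable (h0 : IsInitial (𝟙_ (Variety L E))) (D : Variety L E) [GrpObj D]

theorem grp_zero_mul (a : D.carrier) : μ[D] (pair (zero h0 D) a) = a := by
  have := congrArg (fun k => k (pair PUnit.unit a)) (MonObj.one_mul D)
  exact (congrArg (fun z => μ[D] (pair z a)) (hom_unit_apply h0 η[D] PUnit.unit).symm).trans this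

theorem grp_mul_zero (a : D.carrier) : μ[D] (pair a (zero h0 D)) = a := by
  have := congrArg (fun k => k (pair a PUnit.unit)) (MonObj.mul_one D)
  exact (congrArg (fun z => μ[D] (pair a z)) (hom_unit_apply h0 η[D] PUnit.unit).symm).trans this

/-- The subtraction of an internal group. -/
def grpSub : D ⊗ D ⟶ D := lift (fst D D) (snd D D ≫ GrpObj.inv) ≫ μ[D]

theorem isSubtraction_grpSub : IsSubtraction h0 (grpSub D) where
  self a := (congrArg (fun k => k a) (GrpObj.right_inv D)).trans (hom_unit_apply h0 η[D] _)
  right_zero a := by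
    change μ[D] (pair a ((GrpObj.inv : D ⟶ D) (zero h0 D))) = a
    rw [map_zero h0, grp_mul_zero]

end GrpObj

/-- Every homomorphism between internal groups preserves the multiplication. -/
theorem isMonHom (h0 : IsInitial (𝟙_ (Variety L E))) (hm : CongruenceModular L E)
    {D A : Variety L E} [GrpObj D] [GrpObj A] (f : D ⟶ A) :
    IsMonHom f where
  one_hom := h0.hom_ext _ _
  mul_hom := by
    refine (isSubtraction_grpSub h0 A).hom_ext_axes hm (fun a => ?_) fun b => ?_
    · change f (μ[D] (pair a (zero h0 D))) = μ[A] (pair (f a) (f (zero h0 D)))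
      rw [grp_mul_zero, map_zero h0, grp_mul_zero]
    · change f (μ[D] (pair (zero h0 D) b)) = μ[A] (pair (f (zero h0 D)) (f b))
      rw [grp_zero_mul, map_zero h0, grp_zero_mul]

/-- An algebra carries at most one internal group structure. -/
theorem grpObj_unique (h0 : IsInitial (𝟙_ (Variety L E))) (hm : CongruenceModular L E)
    {D : Variety L E} (G G' : GrpObj D) : G = G' := by
  -- The identity is a homomorphism between the two structures.
  have := @isMonHom L E _ h0 hm D D G G' (𝟙 D)
  have hmul := this.mul_hom
  refine GrpObj.ext _ _ (MonObj.ext _ _ ?_)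
  simpa using hmul

/-- A homomorphism between internal abelian groups as a homomorphism of groups. -/
def commGrpHom (h0 : IsInitial (𝟙_ (Variety L E))) (hm : CongruenceModular L E)
    {A B : CommGrp (Variety L E)} (f : A.X ⟶ B.X) : A ⟶ B :=
  have := isMonHom h0 hm f
  InducedCategory.homMk (Grp.homMk f)

/-! ### The diagonal punctuation -/

/-- The least congruence collapsing the diagonal. -/
def diagCongruence (X : Variety L E) : Congruence L (X ⊗ X).carrier :=
  sInf {c | ∀ x y : X.carrier, c.toSetoid (pair x x) (pair y y)}

theorem diagCongruence_diag (X : Variety L E) (x y : X.carrier) :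
    (diagCongruence X).toSetoid (pair x x) (pair y y) := by
  rintro _ ⟨c, hc, rfl⟩
  exact hc x y

theorem diagCongruence_le {X D : Variety L E} {f : X ⊗ X ⟶ D}
    (hf : ∀ x y, f (pair x x) = f (pair y y)) : diagCongruence X ≤ ker f :=
  sInf_le hf

theorem comp_eq_iff_diag (h0 : IsInitial (𝟙_ (Variety L E))) {X D : Variety L E}
    {w : X ⊗ X ⟶ D} {z : 𝟙_ (Variety L E) ⟶ D} :
    lift (𝟙 X) (𝟙 X) ≫ w = toUnit X ≫ z ↔ ∀ x, w (pair x x) = zero h0 D := by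
  constructor
  · exact fun h x => (congrArg (fun k => k x) h).trans (hom_unit_apply h0 z _)
  · exact fun h => hom_ext_apply fun x => (h x).trans (hom_unit_apply h0 z _).symm

theorem isDiagonalPunctuation_quot (h0 : IsInitial (𝟙_ (Variety L E))) (X : Variety L E) :
    IsDiagonalPunctuation (quotMk (X ⊗ X) (diagCongruence X)) (h0.to _) := by
  have h₁ {D : Variety L E} {w : X ⊗ X ⟶ D} {z : 𝟙_ (Variety L E) ⟶ D}
      (h : lift (𝟙 X) (𝟙 X) ≫ w = toUnit X ≫ z) (p q) (hpq : quotMk _ (diagCongruence X) p =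
        quotMk _ (diagCongruence X) q) : w p = w q :=
    diagCongruence_le (fun x y => ((comp_eq_iff_diag h0).1 h x).trans
      ((comp_eq_iff_diag h0).1 h y).symm) (quotMk_eq_iff.1 hpq)
  refine ⟨⟨(comp_eq_iff_diag h0).2 fun x => ?_⟩, ⟨PushoutCocone.IsColimit.mk _
    (fun s => descend _ (quotMk_surjective _ _) s.inl (h₁ s.condition))
    (fun s => hom_ext_apply fun p =>
      descend_apply _ (quotMk_surjective _ _) _ (h₁ s.condition) p) (fun s => h0.hom_ext _ _)
    fun s m hm _ => hom_ext_apply fun q => ?_⟩⟩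
  · rw [← map_zero h0 (quotMk _ _), ← pair_zero, quotMk_eq_iff]
    exact diagCongruence_diag X _ _
  · obtain ⟨p, rfl⟩ := quotMk_surjective _ _ q
    rw [descend_apply]
    exact congrArg (fun k => k p) hm

section Punctuation

variable (h0 : IsInitial (𝟙_ (Variety L E))) {X D : Variety L E} {w : X ⊗ X ⟶ D}
  {z : 𝟙_ (Variety L E) ⟶ D} (hD : IsDiagonalPunctuation w z)

include h0 hD

theorem punctuation_diag (x : X.carrier) : w (pair x x) = zero h0 D :=
  (comp_eq_iff_diag h0).1 hD.w x

/-- Every pushout is isomorphic to the quotient by `diagCongruence`. -/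
theorem punctuation_surjective : Function.Surjective w := by
  have h := isDiagonalPunctuation_quot h0 X
  have hw : quotMk (X ⊗ X) (diagCongruence X) ≫ (h.isoIsPushout _ _ hD).hom = w :=
    h.inl_isoIsPushout_hom _ _ hD
  rw [← hw]
  exact (surjective_of_isIso (h.isoIsPushout _ _ hD).hom).comp (quotMk_surjective _ _)

theorem diagonalComparison_surjective (hm : CongruenceModular L E) :
    Function.Surjective (diagonalComparison h0 w) := by
  intro d
  obtain ⟨p, rfl⟩ := punctuation_surjective h0 hD d
  obtain ⟨a, b, rfl⟩ := eq_pair p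
  obtain ⟨c, hc⟩ := exists_eq_zero_pair h0 hm
    (fun x y => (punctuation_diag h0 hD x).trans (punctuation_diag h0 hD y).symm) a b
  exact ⟨c, hc.symm⟩

/-- The subtraction is `η x - η y = ω (y, x)`, obtained by descending the swapped `ω` along the
surjection `η × η`. -/
theorem exists_isSubtraction (hm : CongruenceModular L E) :
    ∃ s : D ⊗ D ⟶ D, IsSubtraction h0 s := by
  have hd := punctuation_diag h0 hD
  have hc := diagonalComparison_surjective h0 hD hm
  let e := diagonalComparison h0 w
  have he (x) : e x = w (pair (zero h0 X) x) := rfl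
  let q : X ⊗ X ⟶ D ⊗ D := lift (fst X X ≫ e) (snd X X ≫ e)
  have hq : Function.Surjective q := by
    intro p
    obtain ⟨a, b, rfl⟩ := eq_pair p
    obtain ⟨x, rfl⟩ := hc a
    obtain ⟨y, rfl⟩ := hc b
    exact ⟨pair x y, rfl⟩
  have hs (p p') (h : q p = q p') :
      (lift (snd X X) (fst X X) ≫ w) p = (lift (snd X X) (fst X X) ≫ w) p' := by
    obtain ⟨x, y, rfl⟩ := eq_pair p
    obtain ⟨x', y', rfl⟩ := eq_pair p'
    have h₁ : w (pair (zero h0 X) x) = w (pair (zero h0 X) x') := congrArg (fst D D) h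
    have h₂ : w (pair (zero h0 X) y) = w (pair (zero h0 X) y') := congrArg (snd D D) h
    -- The chain is `w (y, x) = w (y, x') = w (y', x')`; the last equality is shifted from `w (y,
    -- y') = w (y', y')`.
    exact (shift_fst hm w h₁ y).trans
      (shift_snd hm w (eq_diag_of_eq hm (fun x y => (hd x).trans (hd y).symm) h₂) x')
  have key (x y) : descend q hq _ hs (pair (e x) (e y)) = w (pair y x) :=
    descend_apply q hq _ hs (pair x y)
  refine ⟨descend q hq _ hs, fun a => ?_, fun a => ?_⟩
  · obtain ⟨x, rfl⟩ := hc a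
    exact (key x x).trans (hd x)
  · obtain ⟨x, rfl⟩ := hc a
    rw [← map_zero h0 e]
    exact key x (zero h0 X)

/-- A homomorphism `f` to an internal group induces the homomorphism `w (x, y) ↦ f y - f x`. -/
theorem exists_desc {A : Variety L E} [GrpObj A] (f : X ⟶ A) :
    ∃ k : D ⟶ A, ∀ x y, k (w (pair x y)) = grpSub A (pair (f y) (f x)) := by
  have h : lift (𝟙 X) (𝟙 X) ≫ lift (snd X X ≫ f) (fst X X ≫ f) ≫ grpSub A =
      toUnit X ≫ h0.to A :=
    (comp_eq_iff_diag h0).2 fun x => (isSubtraction_grpSub h0 A).self (f x)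
  exact ⟨hD.desc _ _ h, fun x y => congrArg (fun k => k (pair x y)) (hD.inl_desc _ _ h)⟩

/-- Existence uses `f x - f 0 = f x`; uniqueness is the surjectivity of `η`. -/
theorem existsUnique_commGrpHom (hm : CongruenceModular L E) [GrpObj D] [IsCommMonObj D]
    (A : CommGrp (Variety L E)) (f : X ⟶ A.X) :
    ∃! k : CommGrp.mk D ⟶ A,
      diagonalComparison h0 w ≫ (CommGrp.forget (Variety L E)).map k = f := by
  obtain ⟨k, hk⟩ := exists_desc h0 hD f
  have hk₀ (x) : k (diagonalComparison h0 w x) = f x := by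
    refine (hk (zero h0 X) x).trans ?_
    rw [map_zero h0]
    exact (isSubtraction_grpSub h0 A.X).right_zero _
  refine ⟨commGrpHom h0 hm k, hom_ext_apply hk₀, fun k' hk' => ?_⟩
  refine (CommGrp.forget (Variety L E)).map_injective (hom_ext_apply fun d => ?_)
  obtain ⟨x, rfl⟩ := diagonalComparison_surjective h0 hD hm d
  exact (congrArg (fun k => k x) hk').trans (hk₀ x).symm

end Punctuation

/-! ### The subvariety of internal abelian groups -/

theorem essImage_of_isSubtraction {h0 : IsInitial (𝟙_ (Variety L E))}
    (hm : CongruenceModular L E) {A : Variety L E} {s : A ⊗ A ⟶ A} (hs : IsSubtraction h0 s) :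
    (CommGrp.forget (Variety L E)).essImage A :=
  let _ := hs.grpObj hm
  have := hs.isCommMonObj hm
  (CommGrp.forget (Variety L E)).obj_mem_essImage (CommGrp.mk A)

/-- In an internal group, the subtraction is given by a term. -/
theorem exists_term_grpSub (h0 : IsInitial (𝟙_ (Variety L E))) (hm : CongruenceModular L E) :
    ∃ t : L.Term ℕ, ∀ (A : Variety L E) [GrpObj A] (x : ℕ → A.carrier),
      t.realize x = grpSub A (pair (x 0) (x 1)) := by
  have hD := isDiagonalPunctuation_quot h0 (free L E)
  -- The homomorphism induced by an assignment sends `w (gen 1, gen 0)` to `x 0 - x 1` and `w (0,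
  -- c)` to the value of `c`; any term representing `c` will do.
  obtain ⟨c, hc⟩ := exists_eq_zero_pair h0 hm (fun x y => (punctuation_diag h0 hD x).trans
    (punctuation_diag h0 hD y).symm) (gen 1) (gen 0)
  obtain ⟨t, rfl⟩ := freeMk_surjective c
  refine ⟨t, fun A _ x => ?_⟩
  obtain ⟨k, hk⟩ := exists_desc h0 hD (freeLift x)
  have := (hk _ _).symm.trans ((congrArg k hc).trans (hk _ _))
  rw [map_zero h0, (isSubtraction_grpSub h0 A).right_zero] at this
  exact this.symm

variable (L E) in
/-- The identities satisfied by all the internal groups of a variety. -/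
def groupIdentities : Set (L.Term ℕ × L.Term ℕ) :=
  {e | ∀ (A : Variety L E) [GrpObj A] (x : ℕ → A.carrier), e.1.realize x = e.2.realize x}

/-- That the term is a subtraction and commutes with all operations is expressed by identities valid
in internal groups. -/
theorem exists_isSubtraction_of_satisfies (h0 : IsInitial (𝟙_ (Variety L E)))
    (hm : CongruenceModular L E) {A : Variety L E}
    (hA : Satisfies (groupIdentities L E) A.carrier) :
    ∃ s : A ⊗ A ⟶ A, IsSubtraction h0 s := by
  obtain ⟨t, ht⟩ := exists_term_grpSub h0 hm
  -- Variables of `t` other than the first two are irrelevant in internal groups but perhaps not in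
  -- `A`, so they are all set to `b`.
  let tm (a b : L.Term ℕ) : L.Term ℕ := t.subst (quad a b b b)
  have htm (B : Variety L E) (x : ℕ → B.carrier) (a b : L.Term ℕ) : (tm a b).realize x =
      t.realize (quad (a.realize x) (b.realize x) (b.realize x) (b.realize x)) := by
    rw [FirstOrder.Language.Term.realize_subst, map_quad (FirstOrder.Language.Term.realize x)]
  have htg (B : Variety L E) [GrpObj B] (x : ℕ → B.carrier) (a b : L.Term ℕ) :
      (tm a b).realize x = grpSub B (pair (a.realize x) (b.realize x)) := by
    rw [htm, ht]
    rfl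
  let sub (a b : A.carrier) : A.carrier := t.realize (quad a b b b)
  have hself (a b) : sub a a = sub b b := by
    have := hA (tm (.var 0) (.var 0), tm (.var 1) (.var 1)) (fun B _ x => by
      rw [htg, htg, (isSubtraction_grpSub h0 B).self, (isSubtraction_grpSub h0 B).self])
      (quad a b b b)
    rwa [htm, htm] at this
  have hzero (a) : sub a a = zero h0 A := by
    rw [hself a (zero h0 A)]
    have : quad (zero h0 A) (zero h0 A) (zero h0 A) (zero h0 A) = fun _ => zero h0 A :=
      (map_quad (fun _ => zero h0 A) 0 0 0 0).symm
    simp only [sub, this]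
    exact freeLift_const (funMap_zero h0 A) (freeMk E t)
  have hright (a) : sub a (sub a a) = a := by
    have := hA (tm (.var 0) (tm (.var 0) (.var 0)), .var 0) (fun B _ x => by
      rw [htg, htg, (isSubtraction_grpSub h0 B).self, (isSubtraction_grpSub h0 B).right_zero])
      (quad a a a a)
    rwa [htm, htm] at this
  have hmap {n : ℕ} (o : L.Functions n) (x y : Fin n → A.carrier) :
      sub (funMap o x) (funMap o y) = funMap o fun i => sub (x i) (y i) := by
    -- The tuples `x` and `y` are interleaved: even variables carry `x`, odd ones `y`, and the
    -- unused ones get zero.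
    have := hA (tm (.func o fun i => .var (2 * i)) (.func o fun i => .var (2 * i + 1)),
      .func o fun i => tm (.var (2 * i)) (.var (2 * i + 1))) (fun B _ x => by
        simp only [htg, FirstOrder.Language.Term.realize_func]
        exact map_funMap (grpSub B) o fun i => pair _ _)
      fun k => if h : k / 2 < n then if k % 2 = 0 then x ⟨k / 2, h⟩ else y ⟨k / 2, h⟩
        else zero h0 A
    have h₁ (i : Fin n) : (2 * (i : ℕ) + 1) / 2 = i := by omega
    have h₂ (i : Fin n) : (2 * (i : ℕ) + 1) % 2 = 1 := by omega
    simpa [htm, h₁, h₂] using this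
  refine ⟨homMk (fun p : A.carrier × A.carrier => sub p.1 p.2) fun o p => hmap o _ _,
    hzero, fun a => ?_⟩
  have := hright a
  rwa [hzero] at this

theorem essImage_iff_satisfies (h0 : IsInitial (𝟙_ (Variety L E)))
    (hm : CongruenceModular L E) (A : Variety L E) :
    (CommGrp.forget (Variety L E)).essImage A ↔
      Satisfies (groupIdentities L E) A.carrier := by
  constructor
  · rintro ⟨G, ⟨i⟩⟩
    exact satisfies_of_surjective (A := G.X) i.hom (surjective_of_isIso i.hom)
      fun e he x => he G.X x
  · intro h
    obtain ⟨s, hs⟩ := exists_isSubtraction_of_satisfies h0 hm h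
    exact essImage_of_isSubtraction hm hs

theorem isBirkhoffSubcategory_commGrp (h0 : IsInitial (𝟙_ (Variety L E)))
    (hm : CongruenceModular L E) :
    IsBirkhoffSubcategory (CommGrp.forget (Variety L E)) where
  full := ⟨fun f => ⟨commGrpHom h0 hm f, rfl⟩⟩
  faithful := inferInstance
  reflective := by
    -- The universal arrow `η` is an initial object of the comma category.
    have (X : Variety L E) : HasInitial (StructuredArrow X (CommGrp.forget (Variety L E))) := by
      have hD := isDiagonalPunctuation_quot h0 X
      obtain ⟨s, hs⟩ := exists_isSubtraction h0 hD hm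
      let _ := hs.grpObj hm
      have := hs.isCommMonObj hm
      have key := existsUnique_commGrpHom h0 hD hm
      refine IsInitial.hasInitial (X := StructuredArrow.mk (S := X)
        (T := CommGrp.forget (Variety L E)) (Y := CommGrp.mk _) (diagonalComparison h0 _))
        (IsInitial.ofUniqueHom (fun Y => StructuredArrow.homMk (key Y.right Y.hom).choose
          (key Y.right Y.hom).choose_spec.1) fun Y m => ?_)
      exact StructuredArrow.hom_ext _ _
        ((key Y.right Y.hom).choose_spec.2 m.right (StructuredArrow.w m))
    exact isRightAdjointOfStructuredArrowInitials _
  of_mono f _ h := by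
    rw [essImage_iff_satisfies h0 hm] at h ⊢
    exact satisfies_of_injective f (injective_of_mono f) h
  of_regularEpi f _ h := by
    rw [essImage_iff_satisfies h0 hm] at h ⊢
    exact satisfies_of_surjective f (surjective_of_isRegularEpi f) h

end Variety

end UnivAlg

theorem mainTheorem6 (L : FirstOrder.Language.{u, v}) [L.IsAlgebraic]
    (E : Set (L.Term ℕ × L.Term ℕ))
    (hpointed : IsInitial (𝟙_ (UnivAlg.Variety L E)))
    (hmodular : UnivAlg.CongruenceModular L E) :
    (∀ X : UnivAlg.Variety L E,
      (∃ (D : UnivAlg.Variety L E) (ω : X ⊗ X ⟶ D) (z : 𝟙_ (UnivAlg.Variety L E) ⟶ D),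
        IsDiagonalPunctuation ω z) ∧
      ∀ (D : UnivAlg.Variety L E) (ω : X ⊗ X ⟶ D) (z : 𝟙_ (UnivAlg.Variety L E) ⟶ D),
        IsDiagonalPunctuation ω z →
        (∃ (G : GrpObj D) (_ : IsCommMonObj D),
          η[D] = z ∧
          (∀ G' : GrpObj D, G'.one = z → G' = G) ∧
          ∀ (A : CommGrp (UnivAlg.Variety L E)) (f : X ⟶ A.X),
            ∃! φ : CommGrp.mk D ⟶ A,
              diagonalComparison hpointed ω ≫ (CommGrp.forget _).map φ = f) ∧
        Function.Surjective (diagonalComparison hpointed ω)) ∧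
    IsBirkhoffSubcategory (CommGrp.forget (UnivAlg.Variety L E)) ∧
    ∃ E' : Set (L.Term ℕ × L.Term ℕ), ∀ A : UnivAlg.Variety L E,
      (CommGrp.forget (UnivAlg.Variety L E)).essImage A ↔ UnivAlg.Satisfies E' A.carrier := by
  open UnivAlg.Variety in
  refine ⟨fun X => ⟨⟨_, _, _, isDiagonalPunctuation_quot hpointed X⟩, fun D ω z hD => ⟨?_,
      diagonalComparison_surjective hpointed hD hmodular⟩⟩,
    isBirkhoffSubcategory_commGrp hpointed hmodular,
    groupIdentities L E, essImage_iff_satisfies hpointed hmodular⟩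
  obtain ⟨s, hs⟩ := exists_isSubtraction hpointed hD hmodular
  let G := hs.grpObj hmodular
  have hG := hs.isCommMonObj hmodular
  exact ⟨G, hG, hpointed.hom_ext _ _, fun G' _ => grpObj_unique hpointed hmodular G' G,
    existsUnique_commGrpHom hpointed hD hmodular⟩
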